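/- Let $G$ be a finite group of order $n$, and let $V$ be a simple $\mathbb{C}[G]$-module of dimension $d = \dim_{\mathbb{C}} V$. Let $e$ be a nonnegative integer such that $n = d(d+e)$. If $e > 1$, then $n \le e^{4e^2}$. -/

import Mathlib

/-! If `d ≤ 4 * e ^ 3`, the bound is elementary. Otherwise let `χ` be the character of `V`. Any
other irreducible `σ` of degree `a` has `a ^ 2 ≤ n - d ^ 2 = d * e`. The multiplicity of `V` in `σ ⊗
V` is the average of the character of `σ` with weights `|χ| ^ 2 / n`. These put mass `d / (d + e)`
on the identity, so this integer exceeds `a - 1` and hence equals its upper bound `a`. Thus `σ g =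
1` wherever `χ g ≠ 0` (`eq_one_of_character_ne_zero`).

Let `N` be the common kernel of all these `σ`. Then `χ` is `-e` on `N \ {1}` and `0` off `N`, which
gives `d = e * (|N| - 1)` and `n = e ^ 2 * |N| * (|N| - 1)`. Counting conjugating elements by
characters shows that `N \ {1}` is one conjugacy class and that each `x ∉ N` is conjugate to all of
`x N`.

So `N` is elementary abelian, for a prime `p` which must divide `e`. Some `x ∉ N` has `x ^ p ∈ N`;
it acts unipotently on `N`, so `|N| ≤ |C_N(x)| ^ p`, while `|C_N(x)|` divides `e ^ 2`. Hence `|N| ≤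
e ^ (2 * e)`. -/

/-! ### Unitarizability of finite matrix groups. -/

open scoped ComplexOrder Matrix MatrixOrder Matrix.Norms.L2Operator in
/-- Every finite group of complex matrices is conjugate to a group of unitary matrices. -/
theorem MonoidHom.exists_conj_unitary {G ι : Type*} [Group G] [Finite G] [Fintype ι]
    [DecidableEq ι] (M : G →* Matrix ι ι ℂ) :
    ∃ K : (Matrix ι ι ℂ)ˣ, ∀ g, (K : Matrix ι ι ℂ) * M g * (K⁻¹ : (Matrix ι ι ℂ)ˣ) ∈
      Matrix.unitaryGroup ι ℂ := by
  classical
  have := Fintype.ofFinite G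
  set H : Matrix ι ι ℂ := ∑ h, (M h)ᴴ * M h with hH
  have hpos : H.PosDef := by
    -- The summand at `h = 1` is the identity matrix, which makes the semidefinite sum definite.
    rw [hH, ← Finset.add_sum_erase _ _ (Finset.mem_univ (1 : G))]
    refine Matrix.PosDef.add_posSemidef (by simpa using Matrix.PosDef.one)
      (Matrix.posSemidef_sum _ fun i _ => Matrix.posSemidef_conjTranspose_mul_self _)
  have hinv : ∀ g, (M g)ᴴ * H * M g = H := by
    intro g
    rw [hH, Finset.mul_sum, Finset.sum_mul]
    refine Fintype.sum_equiv (Equiv.mulRight g) _ _ fun h => ?_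
    simp [Matrix.conjTranspose_mul, mul_assoc]
  -- Writing the invariant form as `Kᴴ * K` with `K` invertible turns it into the standard form.
  obtain ⟨y, hy, hHy⟩ := CStarAlgebra.isStrictlyPositive_iff_eq_star_mul_self.mp
    hpos.isStrictlyPositive
  obtain ⟨K, rfl⟩ := hy
  refine ⟨K, fun g => ?_⟩
  rw [Matrix.mem_unitaryGroup_iff', Matrix.star_eq_conjTranspose, Matrix.conjTranspose_mul,
    Matrix.conjTranspose_mul]
  have h1 := hinv g
  rw [hHy, Matrix.star_eq_conjTranspose] at h1
  have h2 : ((K⁻¹ : (Matrix ι ι ℂ)ˣ) : Matrix ι ι ℂ)ᴴ * (K : Matrix ι ι ℂ)ᴴ = 1 := by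
    rw [← Matrix.conjTranspose_mul]; simp
  calc _ = ((K⁻¹ : (Matrix ι ι ℂ)ˣ) : Matrix ι ι ℂ)ᴴ * ((M g)ᴴ * ((K : Matrix ι ι ℂ)ᴴ * K) * M g)
        * ((K⁻¹ : (Matrix ι ι ℂ)ˣ) : Matrix ι ι ℂ) := by simp only [mul_assoc]
    _ = (((K⁻¹ : (Matrix ι ι ℂ)ˣ) : Matrix ι ι ℂ)ᴴ * (K : Matrix ι ι ℂ)ᴴ) *
        (K * ((K⁻¹ : (Matrix ι ι ℂ)ˣ) : Matrix ι ι ℂ)) := by rw [h1]; simp only [mul_assoc]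
    _ = 1 := by rw [h2]; simp

/-! ### Traces of unitary matrices. -/

namespace Matrix

variable {ι : Type*} [Fintype ι] [DecidableEq ι] {U : Matrix ι ι ℂ}

theorem norm_trace_le_card_of_mem_unitaryGroup (hU : U ∈ unitaryGroup ι ℂ) :
    ‖U.trace‖ ≤ Fintype.card ι := by
  refine (norm_sum_le _ _).trans ?_
  simpa using Finset.sum_le_sum fun i (_ : i ∈ Finset.univ) => entry_norm_bound_of_unitary hU i i

/-- Diagonal entries have modulus at most 1, so each must have real part 1; rows of norm 1 then
leave nothing for the other entries. -/
theorem eq_one_of_mem_unitaryGroup_of_re_trace_eq (hU : U ∈ unitaryGroup ι ℂ)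
    (h : U.trace.re = Fintype.card ι) : U = 1 := by
  have hle : ∀ i, (U i i).re ≤ 1 := fun i =>
    (Complex.re_le_norm _).trans (entry_norm_bound_of_unitary hU i i)
  have hdiag : ∀ i, (U i i).re = 1 := by
    have hs : ∑ i, (1 - (U i i).re) = 0 := by
      rw [Finset.sum_sub_distrib, ← Complex.re_sum]
      simp only [Finset.sum_const, Finset.card_univ, nsmul_eq_mul, mul_one]
      rw [← h]; simp [trace]
    intro i
    have := (Finset.sum_eq_zero_iff_of_nonneg fun i _ => sub_nonneg.mpr (hle i)).mp hs i
      (Finset.mem_univ i)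
    linarith
  have hrow : ∀ i, ∑ j, Complex.normSq (U i j) = 1 := by
    intro i
    have h1 := congrFun (congrFun (mem_unitaryGroup_iff.mp hU) i) i
    simp only [mul_apply, star_apply, one_apply_eq, RCLike.star_def, Complex.mul_conj] at h1
    exact_mod_cast h1
  have hne : ∀ i j, i ≠ j → U i j = 0 := by
    intro i j hij
    have h1 := hrow i
    rw [← Finset.add_sum_erase _ _ (Finset.mem_univ i)] at h1
    have h2 : Complex.normSq (U i j) ≤ ∑ k ∈ Finset.univ.erase i, Complex.normSq (U i k) :=
      Finset.single_le_sum (f := fun k => Complex.normSq (U i k))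
        (fun k _ => Complex.normSq_nonneg _) (by simp [hij.symm])
    have h3 : 1 ≤ Complex.normSq (U i i) := by
      rw [Complex.normSq_apply, hdiag i]; nlinarith [mul_self_nonneg (U i i).im]
    exact Complex.normSq_eq_zero.mp (le_antisymm (by linarith) (Complex.normSq_nonneg _))
  ext i j
  rcases eq_or_ne i j with rfl | hij
  · rw [one_apply_eq]
    have h1 := entry_norm_bound_of_unitary hU i i
    have h2 : Complex.normSq (U i i) ≤ 1 := by
      rw [Complex.normSq_eq_norm_sq]; nlinarith [norm_nonneg (U i i)]
    rw [Complex.normSq_apply, hdiag i] at h2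
    have h3 : (U i i).im = 0 := by nlinarith [mul_self_nonneg (U i i).im]
    exact Complex.ext (by simpa using hdiag i) (by simpa using h3)
  · rw [one_apply_ne hij, hne i j hij]

end Matrix

/-! ### Characters of finite groups: size, equality case, inversion. -/

namespace Representation

open scoped ComplexConjugate

section CharacterBounds

variable {G V : Type*} [Group G] [Finite G] [AddCommGroup V] [Module ℂ V] [FiniteDimensional ℂ V]
  (ρ : Representation ℂ G V)

theorem exists_unitary_toMatrix :
    ∃ (ι : Type) (_ : Fintype ι) (_ : DecidableEq ι) (b : Module.Basis ι ℂ V)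
      (K : (Matrix ι ι ℂ)ˣ), Fintype.card ι = Module.finrank ℂ V ∧
      ∀ g, (K : Matrix ι ι ℂ) * LinearMap.toMatrix b b (ρ g) * (K⁻¹ : (Matrix ι ι ℂ)ˣ) ∈
        Matrix.unitaryGroup ι ℂ := by
  let b := Module.finBasis ℂ V
  obtain ⟨K, hK⟩ := MonoidHom.exists_conj_unitary
    ((LinearMap.toMatrixAlgEquiv b).toAlgHom.toRingHom.toMonoidHom.comp ρ)
  exact ⟨_, inferInstance, inferInstance, b, K, by simp, hK⟩

omit [Finite G] [FiniteDimensional ℂ V] in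
theorem trace_conj_toMatrix {ι : Type*} [Fintype ι] [DecidableEq ι] (b : Module.Basis ι ℂ V)
    (K : (Matrix ι ι ℂ)ˣ) (g : G) :
    ((K : Matrix ι ι ℂ) * LinearMap.toMatrix b b (ρ g) * (K⁻¹ : (Matrix ι ι ℂ)ˣ)).trace =
      ρ.character g := by
  rw [Matrix.trace_mul_comm, ← mul_assoc, Units.inv_mul, one_mul, character,
    LinearMap.trace_eq_matrix_trace ℂ b]

theorem norm_character_le (g : G) : ‖ρ.character g‖ ≤ Module.finrank ℂ V := by
  obtain ⟨ι, _, _, b, K, hc, hK⟩ := ρ.exists_unitary_toMatrix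
  rw [← ρ.trace_conj_toMatrix b K, ← hc]
  exact Matrix.norm_trace_le_card_of_mem_unitaryGroup (hK g)

theorem eq_one_of_re_character_eq {g : G} (h : (ρ.character g).re = Module.finrank ℂ V) :
    ρ g = 1 := by
  obtain ⟨ι, _, _, b, K, hc, hK⟩ := ρ.exists_unitary_toMatrix
  rw [← ρ.trace_conj_toMatrix b K, ← hc] at h
  have h1 := Matrix.eq_one_of_mem_unitaryGroup_of_re_trace_eq (hK g) h
  rw [Units.mul_inv_eq_one] at h1
  have h2 : LinearMap.toMatrix b b (ρ g) = 1 := by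
    simpa using congrArg (fun X => (K⁻¹ : (Matrix ι ι ℂ)ˣ).val * X) h1
  apply (LinearMap.toMatrix b b).injective
  rw [h2, LinearMap.toMatrix_one]

theorem character_inv (g : G) : ρ.character g⁻¹ = conj (ρ.character g) := by
  obtain ⟨ι, _, _, b, K, hc, hK⟩ := ρ.exists_unitary_toMatrix
  rw [← ρ.trace_conj_toMatrix b K, ← ρ.trace_conj_toMatrix b K]
  have h := Matrix.mem_unitaryGroup_iff.mp (hK g)
  set A := LinearMap.toMatrix b b (ρ g)
  have h2 : A * LinearMap.toMatrix b b (ρ g⁻¹) = 1 := by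
    rw [← LinearMap.toMatrix_mul, ← map_mul]; simp
  have h3 : ((K : Matrix ι ι ℂ) * A * (K⁻¹ : (Matrix ι ι ℂ)ˣ)) *
      ((K : Matrix ι ι ℂ) * LinearMap.toMatrix b b (ρ g⁻¹) * (K⁻¹ : (Matrix ι ι ℂ)ˣ)) = 1 := by
    calc _ = (K : Matrix ι ι ℂ) * (A * (((K⁻¹ : (Matrix ι ι ℂ)ˣ) : Matrix ι ι ℂ) * K) *
          LinearMap.toMatrix b b (ρ g⁻¹)) * (K⁻¹ : (Matrix ι ι ℂ)ˣ) := by simp only [mul_assoc]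
      _ = 1 := by simp [h2]
  rw [left_inv_eq_right_inv (mul_eq_one_comm.mp h3) h, Matrix.star_eq_conjTranspose,
    Matrix.trace_conjTranspose]
  rfl

end CharacterBounds

end Representation

/-! ### Orthogonality, Schur's lemma and the rigidity of the other irreducibles. -/

namespace Representation

open scoped ComplexConjugate MonoidAlgebra

section Irreducible

variable {G V U : Type*} [Group G] [Fintype G] [AddCommGroup V] [Module ℂ V]
  [FiniteDimensional ℂ V] [AddCommGroup U] [Module ℂ U] [FiniteDimensional ℂ U]
  (ρ : Representation ℂ G V) (σ : Representation ℂ G U)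

omit [Fintype G] in
theorem finrank_ne_zero_of_isIrreducible [IsIrreducible ρ] : Module.finrank ℂ V ≠ 0 := by
  have := IsSimpleModule.nontrivial ℂ[G] ρ.asModule
  have : Nontrivial V := this
  exact Module.finrank_pos.ne'

theorem sum_character_mul_character_inv_self [IsIrreducible ρ] :
    ∑ g, ρ.character g * ρ.character g⁻¹ = Nat.card G := by
  classical
  have hn : (Nat.card G : ℂ) ≠ 0 := by simp
  let _ := invertibleOfNonzero hn
  have h := char_orthonormal ρ ρ
  rw [if_pos ⟨Equiv.refl ρ⟩, inv_mul_eq_iff_eq_mul₀ hn, mul_one] at h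
  exact h

theorem sum_normSq_character [IsIrreducible ρ] :
    ∑ g, Complex.normSq (ρ.character g) = Nat.card G := by
  have h := ρ.sum_character_mul_character_inv_self
  simp_rw [character_inv, Complex.mul_conj] at h
  exact_mod_cast h

theorem sum_character_mul_character_inv_eq_zero [IsIrreducible ρ] [IsIrreducible σ]
    (h : IsEmpty (Equiv ρ σ)) : ∑ g, σ.character g * ρ.character g⁻¹ = 0 := by
  classical
  have hn : (Nat.card G : ℂ) ≠ 0 := by simp
  let _ := invertibleOfNonzero hn
  have h1 := char_orthonormal σ ρ
  rw [if_neg (not_nonempty_iff.mpr h), inv_mul_eq_iff_eq_mul₀ hn, mul_zero] at h1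
  exact h1

omit [Fintype G] in
/-- A linear map commuting with an irreducible representation is a scalar. -/
theorem eq_smul_one_of_forall_commute [IsIrreducible ρ] (T : Module.End ℂ V)
    (hT : ∀ g, T * ρ g = ρ g * T) :
    T = (LinearMap.trace ℂ V T / Module.finrank ℂ V) • (1 : Module.End ℂ V) := by
  obtain ⟨c, hc⟩ := IsIrreducible.algebraMap_intertwiningMap_bijective_of_isAlgClosed (ρ := ρ).2
    ⟨T, hT⟩
  have hc' : T = c • (1 : Module.End ℂ V) := by
    exact (congrArg IntertwiningMap.toLinearMap hc).symm
  have hd : (Module.finrank ℂ V : ℂ) ≠ 0 := by exact_mod_cast ρ.finrank_ne_zero_of_isIrreducible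
  have : LinearMap.trace ℂ V T = c * Module.finrank ℂ V := by rw [hc']; simp
  rw [this, mul_div_cancel_right₀ _ hd, hc']

theorem sum_character_inv_smul [IsIrreducible ρ] :
    ∑ h, ρ.character h⁻¹ • ρ h =
      ((Nat.card G : ℂ) / Module.finrank ℂ V) • (1 : Module.End ℂ V) := by
  rw [ρ.eq_smul_one_of_forall_commute (∑ h, ρ.character h⁻¹ • ρ h)]
  · congr 2
    rw [map_sum, ← ρ.sum_character_mul_character_inv_self]
    exact Finset.sum_congr rfl fun h _ => by rw [map_smul, smul_eq_mul, mul_comm]; rfl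
  · intro g
    rw [Finset.sum_mul, Finset.mul_sum]
    refine Fintype.sum_equiv (MulAut.conj g⁻¹).toEquiv _ _ fun h => ?_
    have : ρ.character (g⁻¹ * h * g)⁻¹ = ρ.character h⁻¹ := by
      rw [← ρ.char_conj h⁻¹ g⁻¹]; congr 1; group
    simp only [MulEquiv.toEquiv_eq_coe, EquivLike.coe_coe, MulAut.conj_apply, inv_inv, this]
    rw [smul_mul_assoc, mul_smul_comm, ← map_mul, ← map_mul]
    congr 2; group

theorem sum_conj [IsIrreducible ρ] (y : G) :
    ∑ a, ρ (a * y * a⁻¹) =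
      ((Nat.card G : ℂ) * ρ.character y / Module.finrank ℂ V) • (1 : Module.End ℂ V) := by
  rw [ρ.eq_smul_one_of_forall_commute (∑ a, ρ (a * y * a⁻¹))]
  · congr 2
    rw [map_sum]
    change ∑ a, ρ.character (a * y * a⁻¹) = _
    simp
  · intro g
    rw [Finset.sum_mul, Finset.mul_sum]
    refine Fintype.sum_equiv (Equiv.mulLeft g⁻¹) _ _ fun h => ?_
    simp only [Equiv.coe_mulLeft]
    rw [← map_mul, ← map_mul]
    congr 1; group

theorem sum_character_conj_mul [IsIrreducible ρ] (x y : G) :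
    ∑ a, ρ.character (a * y * a⁻¹ * x) =
      Nat.card G * ρ.character y * ρ.character x / Module.finrank ℂ V := by
  have h := congrArg (fun T => LinearMap.trace ℂ V (T * ρ x)) (ρ.sum_conj y)
  simp only [Finset.sum_mul, map_sum, ← map_mul, smul_mul_assoc, one_mul, map_smul,
    smul_eq_mul] at h
  change ∑ a, ρ.character (a * y * a⁻¹ * x) = _ * ρ.character x at h
  rw [h]; ring

/-- Bessel's inequality for the indicator function of the identity and two distinct irreducible
characters. -/
theorem sq_finrank_add_sq_finrank_le [IsIrreducible ρ] [IsIrreducible σ]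
    (h : IsEmpty (Equiv ρ σ)) :
    Module.finrank ℂ U ^ 2 + Module.finrank ℂ V ^ 2 ≤ Nat.card G := by
  classical
  set n := Nat.card G
  set a := Module.finrank ℂ U
  set d := Module.finrank ℂ V
  have hn : 0 < n := Nat.card_pos
  have horth : ∑ g, (σ.character g * conj (ρ.character g)).re = 0 := by
    have := ρ.sum_character_mul_character_inv_eq_zero σ h
    simp_rw [character_inv] at this
    rw [← Complex.re_sum, this]; simp
  -- Up to the factor `n`, this is the projection of the indicator of `1` to the span of the two
  -- characters.
  let F : G → ℂ := fun g => a * σ.character g + d * ρ.character g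
  have hF1 : F 1 = (a : ℂ) ^ 2 + d ^ 2 := by simp only [F, char_one]; ring
  have hF : ∑ g, Complex.normSq (F g) = n * ((a : ℝ) ^ 2 + d ^ 2) := by
    have : ∀ g, Complex.normSq (F g) = a ^ 2 * Complex.normSq (σ.character g) +
        d ^ 2 * Complex.normSq (ρ.character g) +
        2 * a * d * (σ.character g * conj (ρ.character g)).re := by
      intro g
      simp only [F, Complex.normSq_add, map_mul, Complex.normSq_natCast, Complex.conj_natCast]
      have : (a : ℂ) * σ.character g * (d * conj (ρ.character g)) =
        ((a * d : ℝ) : ℂ) * (σ.character g * conj (ρ.character g)) := by push_cast; ring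
      rw [this, Complex.re_ofReal_mul]; ring
    simp_rw [this, Finset.sum_add_distrib, ← Finset.mul_sum, horth, sum_normSq_character]
    ring
  have hsplit : Complex.normSq (F 1) ≤ ∑ g, Complex.normSq (F g) :=
    Finset.single_le_sum (f := fun g => Complex.normSq (F g))
      (fun g _ => Complex.normSq_nonneg _) (Finset.mem_univ 1)
  rw [hF, hF1] at hsplit
  have h2 : Complex.normSq ((a : ℂ) ^ 2 + d ^ 2) = ((a : ℝ) ^ 2 + d ^ 2) ^ 2 := by
    have : ((a : ℂ) ^ 2 + d ^ 2) = (((a : ℝ) ^ 2 + d ^ 2 : ℝ) : ℂ) := by push_cast; ring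
    rw [this, Complex.normSq_ofReal]; ring
  rw [h2] at hsplit
  have hd : 0 < d := Nat.pos_of_ne_zero ρ.finrank_ne_zero_of_isIrreducible
  have hd' : (0 : ℝ) < (a : ℝ) ^ 2 + d ^ 2 := by positivity
  have : (a : ℝ) ^ 2 + d ^ 2 ≤ n := by nlinarith
  exact_mod_cast this

/-- The integer is the dimension of the space of intertwiners from `ρ` to `σ ⊗ ρ`. -/
theorem exists_sum_character_mul_normSq_eq :
    ∃ m : ℕ, ∑ g, σ.character g * Complex.normSq (ρ.character g) = m * Nat.card G := by
  have hn : (Nat.card G : ℂ) ≠ 0 := by simp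
  let _ := invertibleOfNonzero hn
  refine ⟨Module.finrank ℂ (IntertwiningMap ρ (σ.tprod ρ)), ?_⟩
  have h := card_inv_mul_sum_char_mul_char_eq_finrank ρ (σ.tprod ρ)
  rw [inv_mul_eq_iff_eq_mul₀ hn, mul_comm] at h
  rw [← h]
  refine Finset.sum_congr rfl fun g _ => ?_
  rw [char_tensor, Pi.mul_apply, character_inv, mul_assoc, Complex.mul_conj]

theorem eq_one_of_character_ne_zero [IsIrreducible ρ] [IsIrreducible σ]
    (h : IsEmpty (Equiv ρ σ)) {d e : ℕ} (hd : Module.finrank ℂ V = d)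
    (hn : Nat.card G = d * (d + e)) (hlarge : 4 * e ^ 3 < d) {g : G} (hg : ρ.character g ≠ 0) :
    σ g = 1 := by
  classical
  set a := Module.finrank ℂ U with ha
  have hbound : a ^ 2 ≤ d * e := by
    have := ρ.sq_finrank_add_sq_finrank_le σ h
    rw [hn, hd] at this
    nlinarith
  -- The threshold on `d` comes from here: `(2 * e * a) ^ 2 ≤ 4 * e ^ 3 * d < d ^ 2`.
  have hsmall : 2 * e * a < d + e := by
    by_contra! hcon
    have : (d + e) ^ 2 ≤ (2 * e * a) ^ 2 := Nat.pow_le_pow_left hcon 2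
    have h2 : (2 * e * a) ^ 2 ≤ d * (4 * e ^ 3) := by
      calc (2 * e * a) ^ 2 = 4 * e ^ 2 * a ^ 2 := by ring
        _ ≤ 4 * e ^ 2 * (d * e) := Nat.mul_le_mul_left _ hbound
        _ = _ := by ring
    nlinarith
  obtain ⟨m, hm⟩ := ρ.exists_sum_character_mul_normSq_eq σ
  have hm' : ∑ g, (σ.character g).re * Complex.normSq (ρ.character g) = m * Nat.card G := by
    have := congrArg Complex.re hm
    rw [Complex.re_sum] at this
    simpa [Complex.re_mul_ofReal] using this
  have hsum := ρ.sum_normSq_character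
  have hle : ∀ g, (σ.character g).re ≤ a := fun g =>
    (Complex.re_le_norm _).trans (σ.norm_character_le g)
  have hge : ∀ g, -(a : ℝ) ≤ (σ.character g).re := fun g =>
    (neg_le_neg (σ.norm_character_le g)).trans (abs_le.mp (Complex.abs_re_le_norm _)).1
  have hone : (σ.character 1).re = a := by simp [ha]
  have hdpos : 0 < d := by omega
  -- Adding `a` makes every summand nonnegative; keeping only the one at `1` gives `2 * a * d ^ 2 ≤
  -- (m + a) * n`.
  have hlow : (a : ℝ) * (d - e) ≤ m * (d + e) := by
    have h1 : ∑ g, ((σ.character g).re + a) * Complex.normSq (ρ.character g) ≥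
        ((σ.character 1).re + a) * Complex.normSq (ρ.character 1) :=
      Finset.single_le_sum
        (f := fun g => ((σ.character g).re + a) * Complex.normSq (ρ.character g))
        (fun g _ => mul_nonneg (by linarith [hge g]) (Complex.normSq_nonneg _))
        (Finset.mem_univ 1)
    simp_rw [add_mul, Finset.sum_add_distrib, ← Finset.mul_sum] at h1
    rw [hm', hsum, hone, char_one, hd, Complex.normSq_natCast, hn] at h1
    push_cast at h1
    have hdr : (0 : ℝ) < d := by exact_mod_cast hdpos
    nlinarith
  -- Integrality enters: `m ≤ a - 1` would give `d + e ≤ 2 * e * a`.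
  have hma : (a : ℝ) ≤ m := by
    by_contra! hcon
    have h1 : m + 1 ≤ a := by exact_mod_cast hcon
    have h2 : (m : ℝ) + 1 ≤ a := by exact_mod_cast h1
    have h3 : (2 * e * a : ℝ) < d + e := by exact_mod_cast hsmall
    have h4 : (0 : ℝ) ≤ d + e := by positivity
    nlinarith
  -- The nonnegative terms now sum to `(a - m) * n ≤ 0`, so each one vanishes.
  have hzero : ∑ g, (a - (σ.character g).re) * Complex.normSq (ρ.character g) ≤ 0 := by
    simp_rw [sub_mul, Finset.sum_sub_distrib, ← Finset.mul_sum]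
    rw [hm', hsum]
    have : (0 : ℝ) ≤ Nat.card G := by positivity
    nlinarith
  have hnonneg : ∀ g ∈ Finset.univ,
      0 ≤ (a - (σ.character g).re) * Complex.normSq (ρ.character g) := fun g _ =>
    mul_nonneg (by linarith [hle g]) (Complex.normSq_nonneg _)
  have h0 := (Finset.sum_eq_zero_iff_of_nonneg hnonneg).mp
    (le_antisymm hzero (Finset.sum_nonneg hnonneg)) g (Finset.mem_univ g)
  apply σ.eq_one_of_re_character_eq
  rcases mul_eq_zero.mp h0 with h0 | h0
  · linarith
  · exact absurd (Complex.normSq_eq_zero.mp h0) hg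

/-- The central idempotent of the group algebra attached to the character of `ρ`. -/
noncomputable def characterIdempotent : ℂ[G] :=
  ((Module.finrank ℂ V : ℂ) / Nat.card G) • ∑ h, MonoidAlgebra.single h (ρ.character h⁻¹)

omit [FiniteDimensional ℂ V] in
theorem asAlgebraHom_characterIdempotent [IsIrreducible ρ] [IsIrreducible σ]
    (φ : Equiv ρ σ) : σ.asAlgebraHom ρ.characterIdempotent = 1 := by
  have hn : (Nat.card G : ℂ) ≠ 0 := by simp
  have hd : (Module.finrank ℂ U : ℂ) ≠ 0 := by exact_mod_cast σ.finrank_ne_zero_of_isIrreducible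
  have hVU : Module.finrank ℂ V = Module.finrank ℂ U := φ.toLinearEquiv.finrank_eq
  simp only [characterIdempotent, map_smul, map_sum, asAlgebraHom_single, char_iso φ, hVU]
  rw [σ.sum_character_inv_smul, smul_smul, div_mul_div_cancel₀ hn, div_self hd, one_smul]

omit [FiniteDimensional ℂ V] in
theorem characterIdempotent_apply (h : G) :
    ρ.characterIdempotent.coeff h =
      (Module.finrank ℂ V : ℂ) / Nat.card G * ρ.character h⁻¹ := by
  classical
  rw [characterIdempotent, MonoidAlgebra.coeff_smul, MonoidAlgebra.coeff_sum]
  simp [Finsupp.single_apply]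

end Irreducible

end Representation

/-! ### Passing from irreducible representations to the group algebra. -/

open scoped MonoidAlgebra ComplexConjugate

/-- The minimal left ideals span `R`, so `x` kills `1`. -/
theorem IsSemisimpleRing.eq_zero_of_forall_simple {R : Type*} [Ring R] [IsSemisimpleRing R] {x : R}
    (h : ∀ m : Submodule R R, IsSimpleModule R m → ∀ y ∈ m, x * y = 0) : x = 0 := by
  have hx : x ∈ (⊤ : Submodule R R).annihilator := by
    rw [← IsSemisimpleModule.sSup_simples_eq_top, sSup_eq_iSup', Submodule.annihilator_iSup,
      Submodule.mem_iInf]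
    rintro ⟨m, hm⟩
    exact Submodule.mem_annihilator.mpr fun y hy => h m hm y hy
  simpa using Submodule.mem_annihilator.mp hx 1 trivial

namespace Representation

section OfModule

variable {k G M : Type*} [Field k] [Group G] [AddCommGroup M] [Module k M] [Module k[G] M]
  [IsScalarTower k k[G] M]

theorem asAlgebraHom_ofModule'_apply (r : k[G]) (x : M) :
    (ofModule' (k := k) (G := G) M).asAlgebraHom r x = r • x := by
  have h := (MonoidAlgebra.lift k (Module.End k M) G).apply_symm_apply (Algebra.lsmul k k M)
  exact congrArg (fun F => F r x) h

theorem isIrreducible_ofModule' [IsSimpleModule k[G] M] :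
    IsIrreducible (ofModule' (k := k) (G := G) M) := by
  rw [irreducible_iff_isSimpleModule_asModule]
  let ψ : (ofModule' (k := k) (G := G) M).asModule ≃ₗ[k[G]] M :=
    { (ofModule' (k := k) (G := G) M).asModuleEquiv.toAddEquiv with
      map_smul' r x := by
        exact asAlgebraHom_ofModule'_apply r ((ofModule' M).asModuleEquiv x) }
  exact IsSimpleModule.congr ψ

end OfModule

/-! ### The normal subgroup `N` and conjugacy when the degree is large. -/

section LargeDegree

variable {G V : Type*} [Group G] [Fintype G] [AddCommGroup V] [Module ℂ V]
  [FiniteDimensional ℂ V] (ρ : Representation ℂ G V)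

/-- On a simple left ideal isomorphic to `ρ` the idempotent acts as 1; on any other, `g` does. -/
theorem single_mul_one_sub_characterIdempotent [IsIrreducible ρ] {d e : ℕ}
    (hd : Module.finrank ℂ V = d) (hn : Nat.card G = d * (d + e)) (hlarge : 4 * e ^ 3 < d) {g : G}
    (hg : ρ.character g ≠ 0) :
    MonoidAlgebra.single g 1 * (1 - ρ.characterIdempotent) = 1 - ρ.characterIdempotent := by
  have : NeZero (Nat.card G : ℂ) := ⟨by simp⟩
  rw [← sub_eq_zero]
  apply IsSemisimpleRing.eq_zero_of_forall_simple
  intro m hm y hy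
  have hirr : IsIrreducible (ofModule' (k := ℂ) (G := G) m) := isIrreducible_ofModule'
  have hfin : FiniteDimensional ℂ m := Module.Finite.trans ℂ[G] _
  set σ := ofModule' (k := ℂ) (G := G) m with hσ
  have key : σ.asAlgebraHom (MonoidAlgebra.single g 1 * (1 - ρ.characterIdempotent) -
      (1 - ρ.characterIdempotent)) = 0 := by
    rw [map_sub, map_mul, map_sub, map_one, asAlgebraHom_single_one]
    by_cases h : Nonempty (Equiv ρ σ)
    · obtain ⟨φ⟩ := h
      rw [ρ.asAlgebraHom_characterIdempotent σ φ]; simp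
    · rw [ρ.eq_one_of_character_ne_zero σ (not_nonempty_iff.mp h) hd hn hlarge hg]; simp
  have h2 := congrArg (fun T => T ⟨y, hy⟩) key
  simp only [hσ, asAlgebraHom_ofModule'_apply, LinearMap.zero_apply] at h2
  exact congrArg Subtype.val h2

/-- The coefficient function of the complement of the central idempotent of `ρ`. -/
noncomputable def complementCoeff (h : G) : ℂ :=
  open Classical in
  (if h = 1 then 1 else 0) - (Module.finrank ℂ V : ℂ) / Nat.card G * ρ.character h⁻¹

omit [FiniteDimensional ℂ V] in
theorem coeff_one_sub_characterIdempotent (h : G) :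
    (1 - ρ.characterIdempotent).coeff h = ρ.complementCoeff h := by
  classical
  rw [MonoidAlgebra.coeff_sub, Finsupp.sub_apply, characterIdempotent_apply, complementCoeff,
    MonoidAlgebra.one_def, MonoidAlgebra.coeff_single, Finsupp.single_apply]
  simp only [eq_comm]

omit [Fintype G] [FiniteDimensional ℂ V] in
theorem complementCoeff_conj (a h : G) : ρ.complementCoeff (a * h * a⁻¹) = ρ.complementCoeff h := by
  have : a * h * a⁻¹ = 1 ↔ h = 1 := by rw [mul_inv_eq_one, mul_eq_left]
  classical
  rw [complementCoeff, complementCoeff, ← ρ.char_conj h⁻¹ a]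
  congr 1
  · exact if_congr this rfl rfl
  · simp only [mul_inv_rev, inv_inv, mul_assoc]

omit [Fintype G] [FiniteDimensional ℂ V] in
theorem complementCoeff_mul_comm (a b : G) :
    ρ.complementCoeff (a * b) = ρ.complementCoeff (b * a) := by
  rw [← ρ.complementCoeff_conj a (b * a)]
  congr 1; group

theorem complementCoeff_inv_mul [IsIrreducible ρ] {d e : ℕ}
    (hd : Module.finrank ℂ V = d) (hn : Nat.card G = d * (d + e)) (hlarge : 4 * e ^ 3 < d) {g : G}
    (hg : ρ.character g ≠ 0) (h : G) : ρ.complementCoeff (g⁻¹ * h) = ρ.complementCoeff h := by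
  have h1 := ρ.single_mul_one_sub_characterIdempotent hd hn hlarge hg
  have h2 := congrArg (fun x : ℂ[G] => x.coeff h) h1
  simp only [MonoidAlgebra.coeff_single_mul_apply, one_mul] at h2
  simpa only [coeff_one_sub_characterIdempotent] using h2

/-- The elements of `G` fixing the complement of the central idempotent of `ρ`. -/
noncomputable def complementKer : Subgroup G where
  carrier := {g | ∀ h, ρ.complementCoeff (g * h) = ρ.complementCoeff h}
  one_mem' h := by rw [one_mul]
  mul_mem' {a b} ha hb h := by rw [mul_assoc, ha, hb]
  inv_mem' {a} ha h := by rw [← ha, mul_inv_cancel_left]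

instance : ρ.complementKer.Normal where
  conj_mem g hg a h := by
    rw [mul_assoc, mul_assoc, ρ.complementCoeff_mul_comm, mul_assoc, hg,
      ρ.complementCoeff_mul_comm, ← mul_assoc, mul_inv_cancel, one_mul]

/-- The indicator of `1` is split into its `ρ`-part, summed over conjugates by Schur's lemma, and
its complement, which is invariant under translation by `N`. -/
theorem card_conj_eq [IsIrreducible ρ] [DecidableEq G] (x y : G) :
    ((Finset.univ.filter fun a => a * x * a⁻¹ = y).card : ℂ) =
      ∑ a, ρ.complementCoeff (a * x * a⁻¹ * y⁻¹) + ρ.character x⁻¹ * ρ.character y := by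
  have hn : (Nat.card G : ℂ) ≠ 0 := by simp
  have hd : (Module.finrank ℂ V : ℂ) ≠ 0 := by exact_mod_cast ρ.finrank_ne_zero_of_isIrreducible
  have h1 : ∀ a, (if a * x * a⁻¹ = y then (1 : ℂ) else 0) =
      ρ.complementCoeff (a * x * a⁻¹ * y⁻¹) +
        (Module.finrank ℂ V : ℂ) / Nat.card G * ρ.character (a * x⁻¹ * a⁻¹ * y) := by
    intro a
    rw [complementCoeff, ρ.char_mul_comm]
    simp [mul_inv_eq_one, ← mul_assoc]
  rw [Finset.card_filter]
  push_cast
  simp_rw [h1]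
  rw [Finset.sum_add_distrib, ← Finset.mul_sum, ρ.sum_character_conj_mul]
  congr 1
  field_simp

variable [IsIrreducible ρ] {d e : ℕ} (hd : Module.finrank ℂ V = d)
  (hn : Nat.card G = d * (d + e))

include hd hn

omit [Fintype G] in
theorem complementCoeff_one : ρ.complementCoeff 1 = (e : ℂ) / (d + e) := by
  have hd0 : (d : ℂ) ≠ 0 := by
    rw [← hd]; exact_mod_cast ρ.finrank_ne_zero_of_isIrreducible
  have hde : ((d : ℂ) + e) ≠ 0 := by
    have : d ≠ 0 := by exact_mod_cast hd0
    exact_mod_cast (by omega : d + e ≠ 0)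
  rw [complementCoeff, if_pos rfl, inv_one, char_one, hn, hd]
  push_cast
  field_simp
  ring

omit [Fintype G] in
-- The complement coefficient is constant on `N`, equal to its value `e / (d + e)` at `1`; away from
-- `1` it is a multiple of the character.
theorem character_eq_of_mem_complementKer {g : G} (hg : g ∈ ρ.complementKer) (h1 : g ≠ 1) :
    ρ.character g = -e := by
  have hd0 : (d : ℂ) ≠ 0 := by
    rw [← hd]; exact_mod_cast ρ.finrank_ne_zero_of_isIrreducible
  have hde : ((d : ℂ) + e) ≠ 0 := by
    have : d ≠ 0 := by exact_mod_cast hd0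
    exact_mod_cast (by omega : d + e ≠ 0)
  have h := (inv_mem hg : g⁻¹ ∈ ρ.complementKer) 1
  rw [ρ.complementCoeff_one hd hn, complementCoeff, if_neg (by simpa using h1), hn, hd] at h
  push_cast at h
  rw [mul_one, inv_inv] at h
  field_simp at h
  linear_combination -h

variable (he : e ≠ 0) (hlarge : 4 * e ^ 3 < d)

include hlarge

theorem character_eq_zero_of_notMem_complementKer {g : G} (hg : g ∉ ρ.complementKer) :
    ρ.character g = 0 := by
  by_contra h
  apply hg
  rw [← inv_mem_iff]
  exact ρ.complementCoeff_inv_mul hd hn hlarge h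

/-- As the character vanishes off `N`, as many elements conjugate `x` to `x * z` as centralize `x`.
-/
theorem isConj_mul_of_notMem_complementKer {x z : G} (hx : x ∉ ρ.complementKer)
    (hz : z ∈ ρ.complementKer) : IsConj x (x * z) := by
  classical
  have h1 := ρ.card_conj_eq x x
  have h2 := ρ.card_conj_eq x (x * z)
  have hxz : x * z ∉ ρ.complementKer := fun h => hx ((Subgroup.mul_mem_cancel_right _ hz).mp h)
  rw [ρ.character_eq_zero_of_notMem_complementKer hd hn hlarge hx] at h1
  rw [ρ.character_eq_zero_of_notMem_complementKer hd hn hlarge hxz] at h2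
  have h3 : ∀ a, ρ.complementCoeff (a * x * a⁻¹ * (x * z)⁻¹) =
      ρ.complementCoeff (a * x * a⁻¹ * x⁻¹) := by
    intro a
    rw [mul_inv_rev, ρ.complementCoeff_mul_comm, mul_assoc, inv_mem hz,
      ρ.complementCoeff_mul_comm]
  simp_rw [h3] at h2
  have h4 : (Finset.univ.filter fun a => a * x * a⁻¹ = x * z).card =
      (Finset.univ.filter fun a => a * x * a⁻¹ = x).card := by
    exact_mod_cast h2.trans h1.symm
  have h5 : 0 < (Finset.univ.filter fun a => a * x * a⁻¹ = x).card :=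
    Finset.card_pos.mpr ⟨1, by simp⟩
  rw [← h4] at h5
  obtain ⟨a, ha⟩ := Finset.card_pos.mp h5
  exact isConj_iff.mpr ⟨a, by simpa using ha⟩

include he

omit hlarge in
-- The number of conjugating elements is `n * e / (d + e) + e ^ 2 > 0`.
theorem isConj_of_mem_complementKer {x y : G} (hx : x ∈ ρ.complementKer)
    (hy : y ∈ ρ.complementKer) (hx1 : x ≠ 1) (hy1 : y ≠ 1) : IsConj x y := by
  classical
  have h := ρ.card_conj_eq x y
  rw [ρ.character_eq_of_mem_complementKer hd hn (inv_mem hx) (by simpa using hx1),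
    ρ.character_eq_of_mem_complementKer hd hn hy hy1] at h
  have hd0 : d ≠ 0 := by rw [← hd]; exact ρ.finrank_ne_zero_of_isIrreducible
  have hd0' : (d : ℂ) ≠ 0 := by exact_mod_cast hd0
  have hde : ((d : ℂ) + e) ≠ 0 := by exact_mod_cast (by omega : d + e ≠ 0)
  have h3 : ∀ a, ρ.complementCoeff (a * x * a⁻¹ * y⁻¹) = (e : ℂ) / (d + e) := by
    intro a
    have hm : a * x * a⁻¹ * y⁻¹ ∈ ρ.complementKer :=
      mul_mem (Subgroup.Normal.conj_mem inferInstance x hx a) (inv_mem hy)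
    rw [← ρ.complementCoeff_one hd hn, ← hm 1, mul_one]
  simp_rw [h3] at h
  rw [Finset.sum_const, Finset.card_univ, Fintype.card_eq_nat_card, hn, nsmul_eq_mul] at h
  have h4 : (Finset.univ.filter fun a => a * x * a⁻¹ = y).card = d * e + e * e := by
    have : ((Finset.univ.filter fun a => a * x * a⁻¹ = y).card : ℂ) = d * e + e * e := by
      rw [h]; push_cast; field_simp
    exact_mod_cast this
  have h5 : 0 < (Finset.univ.filter fun a => a * x * a⁻¹ = y).card := by
    rw [h4]; positivity
  obtain ⟨a, ha⟩ := Finset.card_pos.mp h5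
  exact isConj_iff.mpr ⟨a, by simpa using ha⟩

/-- The norm of the character gives `d ^ 2 + e ^ 2 * (|N| - 1) = d * (d + e)`. -/
theorem card_complementKer : e * (Nat.card ρ.complementKer - 1) = d := by
  classical
  have h := ρ.sum_normSq_character
  rw [← Finset.add_sum_erase _ _ (Finset.mem_univ (1 : G)), char_one, hd, hn,
    Complex.normSq_natCast] at h
  have h1 : ∑ g ∈ Finset.univ.erase 1, Complex.normSq (ρ.character g) =
      ∑ g ∈ Finset.univ.erase 1, if g ∈ ρ.complementKer then (e : ℝ) * e else 0 := by
    refine Finset.sum_congr rfl fun g hg => ?_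
    split_ifs with hm
    · rw [ρ.character_eq_of_mem_complementKer hd hn hm (Finset.ne_of_mem_erase hg),
        Complex.normSq_neg, Complex.normSq_natCast]
    · rw [ρ.character_eq_zero_of_notMem_complementKer hd hn hlarge hm, map_zero]
  have h2 : ((Finset.univ.erase (1 : G)).filter (· ∈ ρ.complementKer)).card =
      Nat.card ρ.complementKer - 1 := by
    rw [Finset.filter_erase, Finset.card_erase_of_mem (by simp [one_mem]),
      Nat.card_eq_fintype_card, Fintype.card_subtype]
  rw [h1, ← Finset.sum_filter, Finset.sum_const, h2, nsmul_eq_mul] at h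
  push_cast at h
  have he' : (e : ℝ) ≠ 0 := by exact_mod_cast he
  have h3 : (e : ℝ) * (Nat.card ρ.complementKer - 1 : ℕ) = d := by
    apply mul_left_cancel₀ he'
    linear_combination h
  exact_mod_cast h3

end LargeDegree

end Representation

/-! ### Fixed points of unipotent automorphisms. -/

/-- `f` maps the kernel of `f ^ (k + 1)` into that of `f ^ k`, with fibres no larger than the kernel
of `f`. -/
theorem Module.End.card_ker_pow_le {R A : Type*} [Ring R] [AddCommGroup A] [Module R A] [Finite A]
    (f : Module.End R A) (k : ℕ) :
    Nat.card (LinearMap.ker (f ^ k)) ≤ Nat.card (LinearMap.ker f) ^ k := by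
  induction k with
  | zero =>
    have : LinearMap.ker (f ^ 0) = ⊥ := by rw [pow_zero]; exact LinearMap.ker_id
    rw [this]; simp
  | succ k ih =>
    let g : LinearMap.ker (f ^ (k + 1)) →ₗ[R] LinearMap.ker (f ^ k) :=
      (f ∘ₗ (LinearMap.ker (f ^ (k + 1))).subtype).codRestrict _ fun x => by
        exact (congrArg (fun T => T x.1) (pow_succ f k)).symm.trans (LinearMap.mem_ker.mp x.2)
    have hker : Nat.card (LinearMap.ker g) ≤ Nat.card (LinearMap.ker f) :=
      Nat.card_le_card_of_injective
        (fun x => (⟨x.1.1, congrArg Subtype.val (LinearMap.mem_ker.mp x.2)⟩ : LinearMap.ker f))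
        fun x y h => Subtype.ext (Subtype.ext (Subtype.mk.inj h))
    rw [(LinearMap.ker g).card_eq_card_quotient_mul_card,
      Nat.card_congr g.quotKerEquivRange.toEquiv,
      pow_succ' (Nat.card _)]
    exact Nat.mul_le_mul hker
      ((Nat.card_le_card_of_injective _ Subtype.val_injective).trans ih)

/-- In characteristic `p`, `(s - 1) ^ p = s ^ p - 1 = 0`. -/
theorem Module.End.card_le_card_ker_sub_one_pow {A : Type*} [AddCommGroup A] [Finite A]
    [Nontrivial A] {p : ℕ} [Fact p.Prime] (hA : ∀ a : A, p • a = 0) (s : Module.End ℤ A)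
    (hs : s ^ p = 1) : Nat.card A ≤ Nat.card (LinearMap.ker (s - 1)) ^ p := by
  have hnt : Nontrivial (Module.End ℤ A) := by
    obtain ⟨a, ha⟩ := exists_ne (0 : A)
    exact ⟨⟨1, 0, fun h => ha (by simpa using congrArg (fun f => f a) h)⟩⟩
  have h0 : (p : Module.End ℤ A) = 0 := by
    ext a
    rw [Module.End.natCast_apply, hA a, LinearMap.zero_apply]
  have : CharP (Module.End ℤ A) p := (CharP.charP_iff_prime_eq_zero Fact.out).mpr h0
  have hf : (s - 1) ^ p = 0 := by
    rw [sub_pow_char_of_commute _ (Commute.one_right s), hs, one_pow, sub_self]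
  have h := Module.End.card_ker_pow_le (s - 1) p
  rwa [hf, LinearMap.ker_zero, Nat.card_congr Submodule.topEquiv.toEquiv] at h

/-- If conjugation by `x` induces an automorphism of order dividing `p` on an elementary abelian
normal `p`-subgroup `N`, then `N` has order at most `|C_N(x)| ^ p`. -/
theorem Subgroup.card_le_card_inf_centralizer_pow {G : Type*} [Group G] [Finite G]
    (N : Subgroup G) [N.Normal] [Nontrivial N] {p : ℕ} [Fact p.Prime]
    (hcomm : ∀ a ∈ N, ∀ b ∈ N, a * b = b * a) (hexp : ∀ a ∈ N, a ^ p = 1) {x : G}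
    (hx : x ^ p ∈ N) :
    Nat.card N ≤ Nat.card (N ⊓ Subgroup.centralizer {x} : Subgroup G) ^ p := by
  let _ : CommGroup N := { (inferInstance : Group N) with
    mul_comm := fun a b => Subtype.ext (hcomm a a.2 b b.2) }
  let s : Module.End ℤ (Additive N) :=
    (MonoidHom.toAdditive (MulAut.conjNormal x : N ≃* N).toMonoidHom).toIntLinearMap
  have hpow : ∀ (k : ℕ) (a : N),
      (((s ^ k) (Additive.ofMul a)).toMul : G) = x ^ k * a * (x ^ k)⁻¹ := by
    intro k
    induction k with
    | zero => intro a; simp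
    | succ k ih =>
      intro a
      have : (s ^ (k + 1)) (Additive.ofMul a) = (s ^ k) (Additive.ofMul (MulAut.conjNormal x a)) := by
        rw [pow_succ]; rfl
      rw [this, ih, MulAut.conjNormal_apply]
      group
  -- `s ^ p` is conjugation by `x ^ p`, an element of the abelian group `N`.
  have hs : s ^ p = 1 := by
    ext a
    change ((s ^ p) a).toMul.1 = a.toMul.1
    have := hpow p a.toMul
    rw [ofMul_toMul] at this
    rw [this, hcomm _ hx _ a.toMul.2]
    group
  have h := Module.End.card_le_card_ker_sub_one_pow (A := Additive N) (p := p)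
    (fun a => by
      apply Additive.toMul.injective
      exact Subtype.ext (hexp a.toMul a.toMul.2)) s hs
  refine h.trans (Nat.pow_le_pow_left ?_ p)
  refine Nat.card_le_card_of_injective
    (fun a => (⟨(a.1.toMul : G), a.1.toMul.2, ?_⟩ : (N ⊓ Subgroup.centralizer {x} : Subgroup G)))
    fun a b hab => ?_
  · have h1 : s a.1 = a.1 := by
      have : s a.1 - a.1 = 0 := LinearMap.mem_ker.mp a.2
      rwa [sub_eq_zero] at this
    have h2 : x * (a.1.toMul : G) * x⁻¹ = a.1.toMul := congrArg (fun y => (y.toMul : G)) h1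
    change _ ∈ Subgroup.centralizer {x}
    rw [Subgroup.mem_centralizer_singleton_iff]
    exact (mul_inv_eq_iff_eq_mul.mp h2).symm
  · apply Subtype.ext
    apply Additive.toMul.injective
    exact Subtype.ext (Subtype.mk.inj hab)

/-! ### Conjugacy classes and the bound for `N`. -/

theorem ncard_isConj_mul_card_centralizer {G : Type*} [Group G] [Finite G] (x : G) :
    {y | IsConj x y}.ncard * Nat.card (Subgroup.centralizer {x}) = Nat.card G := by
  have h := (MulAction.stabilizer (ConjAct G) x).card_mul_index
  rw [MulAction.index_stabilizer, ConjAct.orbit_eq_carrier_conjClasses, mul_comm,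
    ← Subgroup.nat_card_centralizer_nat_card_stabilizer] at h
  change _ = Nat.card G at h
  convert h using 3
  ext y
  rw [ConjClasses.mem_carrier_iff_mk_eq, ConjClasses.mk_eq_mk_iff_isConj, isConj_comm]
  rfl

namespace Subgroup

variable {G : Type*} [Group G] [Finite G] (N : Subgroup G) [N.Normal]

omit [Finite G] in
-- The class of `x` is a union of cosets of `N`.
theorem card_dvd_ncard_isConj (hcamina : ∀ x ∉ N, ∀ z ∈ N, IsConj x (x * z)) {x : G}
    (hx : x ∉ N) : Nat.card N ∣ {y | IsConj x y}.ncard := by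
  set t : Set (G ⧸ N) := QuotientGroup.mk '' {y | IsConj x y} with ht
  have hmem : ∀ y, IsConj x y → y ∉ N := by
    rintro y hy hyN
    obtain ⟨c, hc⟩ := isConj_iff.mp hy.symm
    exact hx (hc ▸ Normal.conj_mem inferInstance y hyN c)
  have h : (QuotientGroup.mk ⁻¹' t : Set G) = {y | IsConj x y} := by
    refine Set.Subset.antisymm ?_ (Set.subset_preimage_image _ _)
    rintro y ⟨w, hw, hwy⟩
    have := hcamina w (hmem w hw) _ (QuotientGroup.eq.mp hwy)
    rw [mul_inv_cancel_left] at this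
    exact hw.trans this
  rw [← h, ← Nat.card_coe_set_eq, Nat.card_congr (QuotientGroup.preimageMkEquivSubgroupProdSet N t),
    Nat.card_prod]
  exact dvd_mul_right _ _

/-- A nontrivial central element of `N` exists, and its conjugates in `G`, which are central in `N`
too, exhaust `N \ {1}`. -/
theorem mul_comm_of_forall_isConj {p : ℕ} [Fact p.Prime] (hp : IsPGroup p N) [Nontrivial N]
    (hconj : ∀ x ∈ N, ∀ y ∈ N, x ≠ 1 → y ≠ 1 → IsConj x y) {a b : G} (ha : a ∈ N) (hb : b ∈ N) :
    a * b = b * a := by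
  rcases eq_or_ne a 1 with rfl | ha1
  · simp
  have := hp.center_nontrivial
  obtain ⟨⟨⟨c, hcN⟩, hcc⟩, hc1⟩ := exists_ne (1 : center N)
  have hc1 : c ≠ 1 := fun h => hc1 (Subtype.ext (Subtype.ext h))
  obtain ⟨g, hg⟩ := isConj_iff.mp (hconj c hcN a ha hc1 ha1)
  have hb' : g⁻¹ * b * g ∈ N := by
    simpa using Normal.conj_mem (H := N) inferInstance b hb g⁻¹
  have h1 : (g⁻¹ * b * g) * c = c * (g⁻¹ * b * g) :=
    congrArg Subtype.val (mem_center_iff.mp hcc ⟨_, hb'⟩)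
  rw [← hg]
  calc g * c * g⁻¹ * b = g * (c * (g⁻¹ * b * g)) * g⁻¹ := by group
    _ = b * (g * c * g⁻¹) := by rw [← h1]; group

omit [N.Normal] in
theorem exists_prime_pow_eq_one_of_forall_isConj [Nontrivial N]
    (hconj : ∀ x ∈ N, ∀ y ∈ N, x ≠ 1 → y ≠ 1 → IsConj x y) :
    ∃ p : ℕ, p.Prime ∧ ∀ a ∈ N, a ^ p = 1 := by
  have hN : Nat.card N ≠ 1 := Finite.one_lt_card.ne'
  have := Fact.mk (Nat.minFac_prime hN)
  obtain ⟨z, hz⟩ := exists_prime_orderOf_dvd_card' _ (Nat.minFac_dvd (Nat.card N))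
  refine ⟨_, Nat.minFac_prime hN, fun a ha => ?_⟩
  rcases eq_or_ne a 1 with rfl | ha1
  · simp
  have hz1 : (z : G) ≠ 1 := by
    intro h
    have : z = 1 := Subtype.ext h
    rw [this, orderOf_one] at hz
    exact (Nat.minFac_prime hN).one_lt.ne hz
  obtain ⟨g, hg⟩ := isConj_iff.mp (hconj z z.2 a ha hz1 ha1)
  have hzp : (z : G) ^ (Nat.card N).minFac = 1 := by
    rw [← hz, ← orderOf_coe, pow_orderOf_eq_one]
  rw [← hg, conj_pow, hzp]; simp

/-- A bound for the order of a normal subgroup `N` of `G` all of whose nontrivial elements are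
conjugate and such that the elements outside of `N` are conjugate to all the elements of
their `N`-cosets. -/
theorem card_le_pow_of_forall_isConj [Nontrivial N] {e : ℕ} (he : 1 < e)
    (hG : Nat.card G = e ^ 2 * Nat.card N * (Nat.card N - 1))
    (hconj : ∀ x ∈ N, ∀ y ∈ N, x ≠ 1 → y ≠ 1 → IsConj x y)
    (hcamina : ∀ x ∉ N, ∀ z ∈ N, IsConj x (x * z)) : Nat.card N ≤ e ^ (2 * e) := by
  obtain ⟨p, hp, hexp⟩ := N.exists_prime_pow_eq_one_of_forall_isConj hconj
  have := Fact.mk hp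
  have hq : 1 < Nat.card N := Finite.one_lt_card
  have hpgroup : IsPGroup p N := fun a => ⟨1, by
    rw [pow_one]; exact Subtype.ext (hexp a a.2)⟩
  have hcomm : ∀ a ∈ N, ∀ b ∈ N, a * b = b * a := fun a ha b hb =>
    N.mul_comm_of_forall_isConj hpgroup hconj ha hb
  obtain ⟨⟨z, hzN⟩, hz1⟩ := exists_ne (1 : N)
  have hz1 : z ≠ 1 := fun h => hz1 (Subtype.ext h)
  have hzorder : orderOf z = p := orderOf_eq_prime (hexp z hzN) hz1
  have hclass : {y | IsConj z y} = (N : Set G) \ {1} := by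
    ext y
    constructor
    · intro hy
      obtain ⟨c, hc⟩ := isConj_iff.mp hy
      refine ⟨hc ▸ Normal.conj_mem inferInstance z hzN c, ?_⟩
      rintro rfl
      exact hz1 (isConj_one_left.mp hy)
    · rintro ⟨hy, hy1⟩
      exact hconj z hzN y hy hz1 hy1
  have hcent : Nat.card (centralizer {z}) = e ^ 2 * Nat.card N := by
    have h := ncard_isConj_mul_card_centralizer z
    rw [hclass, Set.ncard_sdiff_singleton_of_mem (by exact N.one_mem), hG, mul_comm,
      ← Nat.card_coe_set_eq] at h
    change _ * (Nat.card N - 1) = _ at h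
    exact Nat.eq_of_mul_eq_mul_right (by omega) h
  -- Otherwise `z` commutes with some `x` of prime order `r ∣ e`, `r ≠ p`; then `x * z` has order `r
  -- * p` yet is conjugate to `x`.
  have hpe : p ∣ e := by
    have hr := Nat.minFac_prime he.ne'
    have := Fact.mk hr
    obtain ⟨⟨x, hxz⟩, hx⟩ := exists_prime_orderOf_dvd_card' (G := centralizer {z}) e.minFac (by
      rw [hcent]
      exact Dvd.dvd.mul_right ((Nat.minFac_dvd e).trans (dvd_pow_self e two_ne_zero)) _)
    have hx : orderOf x = e.minFac := by rw [← hx, ← orderOf_coe]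
    by_contra hpe
    have hne : e.minFac ≠ p := fun h => hpe (h ▸ Nat.minFac_dvd e)
    have hxN : x ∉ N := by
      intro h
      have := orderOf_dvd_of_pow_eq_one (hexp x h)
      rw [hx] at this
      exact hne ((Nat.prime_dvd_prime_iff_eq hr hp).mp this)
    have hcop : (orderOf x).Coprime (orderOf z) := by
      rw [hx, hzorder]; exact (Nat.coprime_primes hr hp).mpr hne
    have hmul := Commute.orderOf_mul_eq_mul_orderOf_of_coprime
      (mem_centralizer_singleton_iff.mp hxz : x * z = z * x) hcop
    obtain ⟨c, hc⟩ := isConj_iff.mp (hcamina x hxN z hzN)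
    have hord : orderOf (x * z) = orderOf x := by
      rw [← hc]
      exact (MulAut.conj c).orderOf_eq x
    rw [hord, hx, hzorder] at hmul
    have := hr.pos
    have := hp.one_lt
    nlinarith
  obtain ⟨x, hxN, hxp⟩ : ∃ x ∉ N, x ^ p ∈ N := by
    have hquot : p ∣ Nat.card (G ⧸ N) := by
      have h := N.card_eq_card_quotient_mul_card_subgroup
      rw [hG, mul_right_comm] at h
      rw [← Nat.eq_of_mul_eq_mul_right (by omega) h]
      exact Dvd.dvd.mul_right (hpe.trans (dvd_pow_self e two_ne_zero)) _
    obtain ⟨X, hX⟩ := exists_prime_orderOf_dvd_card' p hquot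
    obtain ⟨x, rfl⟩ := QuotientGroup.mk_surjective X
    refine ⟨x, fun h => ?_, ?_⟩
    · rw [(QuotientGroup.eq_one_iff x).mpr h, orderOf_one] at hX
      exact hp.one_lt.ne hX
    · rw [← QuotientGroup.eq_one_iff, QuotientGroup.mk_pow, ← hX, pow_orderOf_eq_one]
  set C : Subgroup G := N ⊓ centralizer {x}
  -- `|N|` divides the class size of `x` and `|C|` its centralizer order, so `|N| * |C|` divides
  -- `|G|`.
  have hdvd : Nat.card C ∣ e ^ 2 * (Nat.card N - 1) := by
    have h1 := mul_dvd_mul (N.card_dvd_ncard_isConj hcamina hxN)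
      (card_dvd_of_le (inf_le_right : C ≤ centralizer {x}))
    rw [ncard_isConj_mul_card_centralizer, hG,
      show e ^ 2 * Nat.card N * (Nat.card N - 1) = Nat.card N * (e ^ 2 * (Nat.card N - 1)) by ring]
      at h1
    exact Nat.dvd_of_mul_dvd_mul_left (by omega) h1
  have hcop : (Nat.card C).Coprime (Nat.card N - 1) := by
    have h1 : Nat.card C ∣ Nat.card N := card_dvd_of_le inf_le_left
    refine Nat.Coprime.coprime_dvd_left h1 ?_
    exact (Nat.coprime_self_sub_right hq.le).mpr (Nat.coprime_one_right _)
  have hC : Nat.card C ≤ e ^ 2 :=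
    Nat.le_of_dvd (by positivity) (hcop.dvd_of_dvd_mul_right hdvd)
  calc Nat.card N ≤ Nat.card C ^ p := N.card_le_card_inf_centralizer_pow hcomm hexp hxp
    _ ≤ (e ^ 2) ^ p := Nat.pow_le_pow_left hC p
    _ ≤ (e ^ 2) ^ e := Nat.pow_le_pow_right (by positivity) (Nat.le_of_dvd (by omega) hpe)
    _ = e ^ (2 * e) := (pow_mul e 2 e).symm

end Subgroup

/-! ### Assembling the two ranges of `d`. -/

theorem mainTheorem6 {G : Type*} [Group G] [Finite G]
    {V : Type*} [AddCommGroup V] [Module ℂ V] [Module (MonoidAlgebra ℂ G) V]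
    [IsScalarTower ℂ (MonoidAlgebra ℂ G) V] [IsSimpleModule (MonoidAlgebra ℂ G) V]
    (n d e : ℕ) (hn : Nat.card G = n) (hd : Module.finrank ℂ V = d)
    (hnde : n = d * (d + e)) (he : 1 < e) :
    n ≤ e ^ (4 * e ^ 2) := by
  have hexp : e ^ 16 ≤ e ^ (4 * e ^ 2) := Nat.pow_le_pow_right (by omega) (by nlinarith)
  rcases le_or_gt d (4 * e ^ 3) with hsmall | hlarge
  · refine le_trans ?_ hexp
    have h4 : 4 ≤ e ^ 2 := by nlinarith
    have h5 : d ≤ e ^ 5 := hsmall.trans (by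
      calc 4 * e ^ 3 ≤ e ^ 2 * e ^ 3 := Nat.mul_le_mul_right _ h4
        _ = e ^ 5 := by ring)
    have h6 : d + e ≤ e ^ 6 := by
      have : e ≤ e ^ 5 := Nat.le_self_pow (by norm_num) e
      calc d + e ≤ 2 * e ^ 5 := by omega
        _ ≤ e * e ^ 5 := Nat.mul_le_mul_right _ he
        _ = e ^ 6 := by ring
    calc n = d * (d + e) := hnde
      _ ≤ e ^ 5 * e ^ 6 := Nat.mul_le_mul h5 h6
      _ = e ^ 11 := by ring
      _ ≤ e ^ 16 := Nat.pow_le_pow_right (by omega) (by norm_num)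
  · have := Fintype.ofFinite G
    have : FiniteDimensional ℂ V := Module.Finite.trans (MonoidAlgebra ℂ G) V
    let ρ := Representation.ofModule' (k := ℂ) (G := G) V
    have : ρ.IsIrreducible := Representation.isIrreducible_ofModule'
    have hcard : Nat.card G = d * (d + e) := hn.trans hnde
    have he0 : e ≠ 0 := by omega
    have hN := ρ.card_complementKer hd hcard he0 hlarge
    set N := ρ.complementKer
    have hN1 : 1 < Nat.card N := by
      by_contra! h
      rw [Nat.sub_eq_zero_of_le h] at hN
      omega
    have : Nontrivial N := Finite.one_lt_card_iff_nontrivial.mp hN1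
    have hcard' : Nat.card G = e ^ 2 * Nat.card N * (Nat.card N - 1) := by
      obtain ⟨m, hm⟩ : ∃ m, Nat.card N = m + 1 := ⟨_, (Nat.succ_pred_eq_of_pos (by omega)).symm⟩
      rw [hm, Nat.add_sub_cancel] at hN ⊢
      rw [hcard, ← hN]; ring
    have hq := N.card_le_pow_of_forall_isConj he hcard'
      (fun x hx y hy => ρ.isConj_of_mem_complementKer hd hcard he0 hx hy)
      (fun x hx z hz => ρ.isConj_mul_of_notMem_complementKer hd hcard hlarge hx hz)
    calc n = e ^ 2 * Nat.card N * (Nat.card N - 1) := by rw [← hn, hcard']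
      _ ≤ e ^ 2 * e ^ (2 * e) * e ^ (2 * e) :=
        Nat.mul_le_mul (Nat.mul_le_mul_left _ hq) ((Nat.sub_le _ _).trans hq)
      _ = e ^ (2 + 2 * e + 2 * e) := by rw [← pow_add, ← pow_add]
      -- `2 + 4 * e ≤ 4 * e ^ 2` because `e ≥ 2`.
      _ ≤ e ^ (4 * e ^ 2) := Nat.pow_le_pow_right (by omega) (by nlinarith)
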